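/- A degree sequence of length $n$ is a sequence $D=(d_1,\dots,d_n)$ of positive integers with $d_i\le n-1$ for all $i$ and with $\sum_i d_i$ even. For an arbitrary vector $D\in\mathbb{N}^n$ let $\mathcal{G}(D)$ be the set of simple graphs on the vertex set $\{1,\dots,n\}$ in which vertex $i$ has degree $d_i$ for every $i$; $D$ is graphic if $\mathcal{G}(D)\neq\emptyset$. For $1\le i,j\le n$ let $1^{+i}_{+j}=e_i+e_j$, where $e_1,\dots,e_n$ are the standard unit vectors (so $1^{+i}_{+i}=2e_i$), and for a graphic $D$ put $$\partial^{++}(D)=\sum_{1\le i<j\le n}\frac{|\mathcal{G}(D+1^{+i}_{+j})|}{|\mathcal{G}(D)|}.$$ For a non-negative integer $\Sigma$ and positive integers $n>c_1\ge c_2$ let $\mathbb{D}(n,\Sigma,c_1,c_2)$ be the set of all degree sequences $D$ of length $n$ with $\sum_i d_i=\Sigma$ and $c_2\le d_i\le c_1$ for all $i$. Theorem. If $\mathbb{D}(n,\Sigma,c_1,c_2)$ is fully graphic, that is, if every one of its members is graphic, then $\partial^{++}(D)\le 3\,n^{13}$ for every $D\in\mathbb{D}(n,\Sigma,c_1,c_2)$.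 The same bound holds when the sum defining $\partial^{++}(D)$ is extended to all pairs $1\le i\le j\le n$. -/

import Mathlib

namespace DegreeRegion

/-- A degree sequence of length `n`: positive integers, none exceeding `n - 1`, with even sum. -/
def IsDegreeSequence {n : ℕ} (d : Fin n → ℕ) : Prop :=
  (∀ i, 0 < d i ∧ d i < n) ∧ Even (∑ i, d i)

open Classical in
/-- The set `𝒢(d)` of realizations of `d`: the simple graphs on the labelled vertex set `Fin n` in
which vertex `v` has degree `d v`. It makes sense for every vector of natural numbers. -/
def realizations {n : ℕ} (d : Fin n → ℕ) : Set (SimpleGraph (Fin n)) :=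
  {G | ∀ v, G.degree v = d v}

/-- A vector is graphic if it has a realization. -/
def IsGraphic {n : ℕ} (d : Fin n → ℕ) : Prop :=
  (realizations d).Nonempty

/-- The simple region `𝔻(n, S, a, b)`: the degree sequences of length `n` with sum `S`, largest
entry at most `a` and smallest entry at least `b`. -/
def simpleRegion (n S a b : ℕ) : Set (Fin n → ℕ) :=
  {d | IsDegreeSequence d ∧ (∀ i, d i ≤ a) ∧ (∀ i, b ≤ d i) ∧ ∑ i, d i = S}

/-- A region is fully graphic if each of its members is graphic. -/
def FullyGraphic {n : ℕ} (R : Set (Fin n → ℕ)) : Prop :=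
  ∀ d ∈ R, IsGraphic d

/-- The perturbation `d + 1^{+i}_{+j}`; for `i = j` it adds `2` to the `i`-th entry. -/
def perturb {n : ℕ} (d : Fin n → ℕ) (i j : Fin n) : Fin n → ℕ :=
  d + Pi.single i 1 + Pi.single j 1

/-- `∂⁺⁺(d)`, the sum over all pairs `i < j` of `|𝒢(d + 1^{+i}_{+j})| / |𝒢(d)|`. -/
noncomputable def boundary {n : ℕ} (d : Fin n → ℕ) : ℚ :=
  ∑ p : Fin n × Fin n with p.1 < p.2,
    ((realizations (perturb d p.1 p.2)).ncard : ℚ) / ((realizations d).ncard : ℚ)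

/-- The variant of `∂⁺⁺(d)` that also counts the perturbations with `i = j`. -/
noncomputable def boundaryWithDiagonal {n : ℕ} (d : Fin n → ℕ) : ℚ :=
  ∑ p : Fin n × Fin n with p.1 ≤ p.2,
    ((realizations (perturb d p.1 p.2)).ncard : ℚ) / ((realizations d).ncard : ℚ)

end DegreeRegion

/-! Let `G` realize `d` with one added at `x` and at `y`. Toggling along an alternating trail from
`y` to `x` that starts and ends with an edge lowers the degrees of both ends by one, or by two if `x
= y`, and so gives a realization of `d`. A trail with at most nine edges is recorded by ten
vertices, and toggling is injective once the list is known; hence such `G` number at most `n ^ 10`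
times the realizations of `d`.

Full graphicness forces a short trail when every neighbour of `y` is a neighbour of `x`
(`FullyGraphic.exists_isAltTrail`). Suppose there is none. Then the neighbours of `y`, with the
vertices reached from two of them by a non-edge and an edge, form a clique `A`. It is joined to
everything outside the set `M` of `y` and the non-neighbours of `A`, and a set `B` inside `M` has no
edges into `M`. Moving degree out of `M` within the region reaches a member violating an
Erdős–Gallai inequality (`FullyGraphic.no_obstruction`).

If the inclusion fails at `w ≠ x`, replacing the edge `yw` by `wx` leads to the case `x = y`, where
it is trivial, at the price of a factor `n`; if `w = x`, the edge `yx` is itself a trail. Each pair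
thus costs at most `2 * n ^ 11`, and there are at most `n ^ 2` pairs. -/

open scoped symmDiff

namespace DegreeRegion

/-! ### Alternating trails and their effect on degrees. -/

section Trails

variable {V : Type*}

/-- The graph formed by the consecutive pairs of a list, each taken modulo two. -/
def pathGraph : List V → SimpleGraph V
  | [] => ⊥
  | [_] => ⊥
  | a :: b :: l => SimpleGraph.edge a b ∆ pathGraph (b :: l)

/-- The unordered pairs of consecutive entries of a list. -/
def consecutivePairs : List V → List (Sym2 V)
  | [] => []
  | [_] => []
  | a :: b :: l => s(a, b) :: consecutivePairs (b :: l)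

/-- The consecutive pairs of the list are alternately edges and non-edges of `G`, the first one
being an edge if and only if the flag is `true`, the last one being an edge. -/
def Alternates (G : SimpleGraph V) : Bool → List V → Prop
  | _, [] => False
  | b, [_] => b = false
  | true, a :: b :: l => G.Adj a b ∧ Alternates G false (b :: l)
  | false, a :: b :: l => Gᶜ.Adj a b ∧ Alternates G true (b :: l)

/-- `a :: l` is an alternating trail of `G` from `a` to `b` that starts and ends with an edge. -/
structure IsAltTrail (G : SimpleGraph V) (a b : V) (l : List V) : Prop where
  alternates : Alternates G true (a :: l)
  nodup : (consecutivePairs (a :: l)).Nodup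
  last : (a :: l).getLast? = some b

theorem symmDiff_edge_adj_of_ne (G : SimpleGraph V) {a b c d : V} (h : s(a, b) ≠ s(c, d)) :
    (G ∆ SimpleGraph.edge a b).Adj c d ↔ G.Adj c d := by
  have h' : ¬ (SimpleGraph.edge a b).Adj c d := by
    rw [SimpleGraph.edge_adj]
    rintro ⟨⟨rfl, rfl⟩ | ⟨rfl, rfl⟩, -⟩
    · exact h rfl
    · exact h Sym2.eq_swap
  simp [symmDiff, h']

theorem Alternates.symmDiff_edge {G : SimpleGraph V} {a b : V} :
    ∀ {l : List V} {f : Bool}, Alternates G f l → s(a, b) ∉ consecutivePairs l →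
      Alternates (G ∆ SimpleGraph.edge a b) f l
  | [], _, h, _ => h
  | [_], _, h, _ => h
  | c :: d :: l, true, h, hn => by
    simp only [consecutivePairs, List.mem_cons, not_or] at hn
    exact ⟨(symmDiff_edge_adj_of_ne G hn.1).2 h.1, h.2.symmDiff_edge hn.2⟩
  | c :: d :: l, false, h, hn => by
    simp only [consecutivePairs, List.mem_cons, not_or] at hn
    refine ⟨?_, h.2.symmDiff_edge hn.2⟩
    have := h.1
    rw [SimpleGraph.compl_adj] at this ⊢
    rwa [symmDiff_edge_adj_of_ne G hn.1]

/-- A loop pair contributes the empty graph, so shorter trails can be padded to a common length. -/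
theorem pathGraph_append_replicate {b : V} (k : ℕ) :
    ∀ l : List V, l.getLast? = some b → pathGraph (l ++ List.replicate k b) = pathGraph l
  | [], h => by simp at h
  | [a], h => by
    obtain rfl : a = b := by simpa using h
    induction k with
    | zero => rfl
    | succ k ih =>
      have : pathGraph ([a] ++ List.replicate (k + 1) a)
          = SimpleGraph.edge a a ∆ pathGraph ([a] ++ List.replicate k a) := rfl
      rw [this, ih]
      simp [pathGraph]
  | a :: c :: l, h => by
    have := pathGraph_append_replicate k (c :: l) (by simpa using h)
    simp only [List.cons_append] at this ⊢
    simp only [pathGraph, this]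

section Degrees

open Classical

variable [Fintype V] [DecidableEq V]

theorem degree_symmDiff_edge_of_adj {G : SimpleGraph V} {a b : V} (h : G.Adj a b) (v : V) :
    G.degree v = (G ∆ SimpleGraph.edge a b).degree v
      + (if v = a then 1 else 0) + (if v = b then 1 else 0) := by
  have hab := h.ne
  simp only [← SimpleGraph.card_neighborFinset_eq_degree]
  by_cases ha : v = a
  · subst ha
    have : (G ∆ SimpleGraph.edge v b).neighborFinset v = (G.neighborFinset v).erase b := by
      ext w
      rw [SimpleGraph.mem_neighborFinset, Finset.mem_erase, SimpleGraph.mem_neighborFinset]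
      simp only [symmDiff, SimpleGraph.sup_adj, SimpleGraph.sdiff_adj, SimpleGraph.edge_adj]
      grind
    rw [this, Finset.card_erase_of_mem (by simpa using h)]
    have : 0 < (G.neighborFinset v).card := Finset.card_pos.2 ⟨b, by simpa using h⟩
    rw [if_pos rfl, if_neg hab]
    omega
  by_cases hb : v = b
  · subst hb
    have : (G ∆ SimpleGraph.edge a v).neighborFinset v = (G.neighborFinset v).erase a := by
      ext w
      rw [SimpleGraph.mem_neighborFinset, Finset.mem_erase, SimpleGraph.mem_neighborFinset]
      simp only [symmDiff, SimpleGraph.sup_adj, SimpleGraph.sdiff_adj, SimpleGraph.edge_adj]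
      grind [G.adj_comm]
    rw [this, Finset.card_erase_of_mem (by simpa using h.symm)]
    have : 0 < (G.neighborFinset v).card := Finset.card_pos.2 ⟨a, by simpa using h.symm⟩
    rw [if_pos rfl, if_neg ha]
    omega
  · have : (G ∆ SimpleGraph.edge a b).neighborFinset v = G.neighborFinset v := by
      ext w
      rw [SimpleGraph.mem_neighborFinset, SimpleGraph.mem_neighborFinset]
      simp only [symmDiff, SimpleGraph.sup_adj, SimpleGraph.sdiff_adj, SimpleGraph.edge_adj]
      grind
    rw [this, if_neg ha, if_neg hb, add_zero, add_zero]

theorem degree_symmDiff_edge_of_not_adj {G : SimpleGraph V} {a b : V} (h : Gᶜ.Adj a b) (v : V) :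
    (G ∆ SimpleGraph.edge a b).degree v = G.degree v
      + (if v = a then 1 else 0) + (if v = b then 1 else 0) := by
  have hadj : (G ∆ SimpleGraph.edge a b).Adj a b := by
    rw [SimpleGraph.compl_adj] at h
    simp [symmDiff, SimpleGraph.edge_adj, h.1, h.2]
  have := degree_symmDiff_edge_of_adj hadj v
  rwa [symmDiff_symmDiff_cancel_right] at this

/-- Toggle one pair at a time: the degree error is one unit of surplus at the end `b`, and at the
current head a surplus before an edge or a deficit before a non-edge. The two cancel when the head
arrives at `b`. -/
theorem Alternates.degree_symmDiff {b : V} {d : V → ℕ} :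
    ∀ {l : List V} {a : V} {G : SimpleGraph V} {f : Bool}, Alternates G f (a :: l) →
      (consecutivePairs (a :: l)).Nodup → (a :: l).getLast? = some b →
      (∀ v, G.degree v + (if v = a ∧ f = false then 1 else 0)
        = d v + (if v = a ∧ f = true then 1 else 0) + (if v = b then 1 else 0)) →
      ∀ v, (G ∆ pathGraph (a :: l)).degree v = d v
  | [], a, G, f, h, _, hl, hd => by
    obtain rfl : a = b := by simpa using hl
    obtain rfl : f = false := h
    intro v
    have := hd v
    rw [pathGraph, symmDiff_bot]
    simpa using this
  | c :: l, a, G, true, h, hn, hl, hd => by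
    intro v
    simp only [consecutivePairs, List.nodup_cons] at hn
    have key := (h.2.symmDiff_edge hn.1).degree_symmDiff (b := b) (d := d) hn.2
      (by simpa using hl) (fun w => by
        have h1 := hd w
        have h2 := degree_symmDiff_edge_of_adj h.1 w
        simp at h1 ⊢
        omega) v
    rw [symmDiff_assoc] at key
    exact key
  | c :: l, a, G, false, h, hn, hl, hd => by
    intro v
    simp only [consecutivePairs, List.nodup_cons] at hn
    have key := (h.2.symmDiff_edge hn.1).degree_symmDiff (b := b) (d := d) hn.2
      (by simpa using hl) (fun w => by
        have h1 := hd w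
        have h2 := degree_symmDiff_edge_of_not_adj h.1 w
        simp at h1 ⊢
        omega) v
    rw [symmDiff_assoc] at key
    exact key

theorem IsAltTrail.degree_symmDiff {G : SimpleGraph V} {a b : V} {l : List V} {d : V → ℕ}
    (h : IsAltTrail G a b l)
    (hd : ∀ v, G.degree v = d v + (if v = a then 1 else 0) + (if v = b then 1 else 0)) (v : V) :
    (G ∆ pathGraph (a :: l)).degree v = d v :=
  h.alternates.degree_symmDiff h.nodup h.last (by simpa using hd) v

end Degrees

end Trails

/-! ### Counting by toggling. -/

section Counting

open Classical in
theorem mem_realizations_perturb {n : ℕ} {d : Fin n → ℕ} {i j : Fin n}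
    {G : SimpleGraph (Fin n)} : G ∈ realizations (perturb d i j) ↔
      ∀ v, G.degree v = d v + (if v = i then 1 else 0) + (if v = j then 1 else 0) := by
  change (∀ v, G.degree v = _) ↔ _
  simp only [perturb, Pi.add_apply, Pi.single_apply]

/-- If each graph in `s` is turned into one in `t` by toggling one of the graphs `g i`, then `s` is
larger than `t` by a factor of at most the number of indices. -/
theorem ncard_le_of_exists_symmDiff {V ι : Type*} [Finite V] [Finite ι]
    {s t : Set (SimpleGraph V)} (g : ι → SimpleGraph V) (h : ∀ G ∈ s, ∃ i, G ∆ g i ∈ t) :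
    s.ncard ≤ Nat.card ι * t.ncard := by
  choose f hf using h
  let F : s → ι × t := fun G => (f G G.2, ⟨(G : SimpleGraph V) ∆ g (f G G.2), hf G G.2⟩)
  have hF : Function.Injective F := by
    intro G H hGH
    have h1 : f G G.2 = f H H.2 := congrArg Prod.fst hGH
    have h2 : (G : SimpleGraph V) ∆ g (f G G.2) = (H : SimpleGraph V) ∆ g (f H H.2) :=
      congrArg (fun z => z.2.1) hGH
    rw [h1] at h2
    exact Subtype.ext (symmDiff_left_injective _ h2)
  have := Nat.card_le_card_of_injective F hF
  rwa [Nat.card_prod, Nat.card_coe_set_eq, Nat.card_coe_set_eq] at this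

theorem ncard_le_of_exists_pathGraph {V : Type*} [Fintype V] {s t : Set (SimpleGraph V)} (k : ℕ)
    (h : ∀ G ∈ s, ∃ l : List V, l.length = k ∧ G ∆ pathGraph l ∈ t) :
    s.ncard ≤ Fintype.card V ^ k * t.ncard := by
  have := ncard_le_of_exists_symmDiff (ι := List.Vector V k) (fun l => pathGraph l.1)
    fun G hG => by
      obtain ⟨l, hl, hlt⟩ := h G hG
      exact ⟨⟨l, hl⟩, hlt⟩
  rwa [Nat.card_eq_fintype_card, card_vector] at this

end Counting

end DegreeRegion

namespace DegreeRegion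

/-! ### Necessary inequalities and degree shifts in the region. -/

section Region

open Finset

/-- One direction of the Erdős–Gallai criterion. -/
theorem IsGraphic.sum_le {n : ℕ} {d : Fin n → ℕ} (h : IsGraphic d) {A B : Finset (Fin n)}
    (hAB : Disjoint A B) : ∑ i ∈ A, d i ≤ #A * (n - 1 - #B) + ∑ i ∈ B, d i := by
  classical
  obtain ⟨G, hG⟩ := h
  have hdeg : ∀ v, d v = #{w | G.Adj v w} := fun v => by
    rw [← hG v, ← SimpleGraph.card_neighborFinset_eq_degree, SimpleGraph.neighborFinset_eq_filter]
  have h1 : ∀ v ∈ A, d v ≤ (n - 1 - #B) + #{w ∈ B | G.Adj v w} := by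
    intro v hv
    have hvB : v ∉ B := disjoint_left.1 hAB hv
    have hsub : ({w | G.Adj v w} : Finset (Fin n)) ⊆
        ((univ.erase v) \ B) ∪ {w ∈ B | G.Adj v w} := by
      intro w hw
      have hw' : G.Adj v w := by simpa using hw
      by_cases hwB : w ∈ B <;> simp [hwB, hw', hw'.ne']
    have hc : #((univ.erase v) \ B) = n - 1 - #B := by
      rw [card_sdiff_of_subset, card_erase_of_mem (mem_univ v), card_univ, Fintype.card_fin]
      intro w hw
      exact mem_erase.2 ⟨fun e => hvB (e ▸ hw), mem_univ w⟩
    calc d v = _ := hdeg v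
      _ ≤ _ := card_le_card hsub
      _ ≤ _ := card_union_le _ _
      _ = _ := by rw [hc]
  have h2 : ∑ v ∈ A, #{w ∈ B | G.Adj v w} ≤ ∑ w ∈ B, d w := by
    have := sum_card_bipartiteAbove_eq_sum_card_bipartiteBelow (s := A) (t := B) G.Adj
    simp only [bipartiteAbove, bipartiteBelow] at this
    rw [this]
    refine sum_le_sum fun w _ => ?_
    rw [hdeg w]
    refine card_le_card fun v hv => ?_
    simp only [mem_filter, mem_univ, true_and] at hv ⊢
    exact hv.2.symm
  calc ∑ v ∈ A, d v ≤ ∑ v ∈ A, ((n - 1 - #B) + #{w ∈ B | G.Adj v w}) := sum_le_sum h1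
    _ = #A * (n - 1 - #B) + ∑ v ∈ A, #{w ∈ B | G.Adj v w} := by
      rw [sum_add_distrib, sum_const, smul_eq_mul]
    _ ≤ _ := by omega

/-- Degrees can be shifted from a set `M` to its complement until one of the two is exhausted. -/
theorem exists_mem_simpleRegion_shift {n S a b : ℕ} (hb : 0 < b) (ha : a < n) (M : Finset (Fin n))
    {d : Fin n → ℕ} (hd : d ∈ simpleRegion n S a b) :
    ∃ e ∈ simpleRegion n S a b, (∀ i ∉ M, d i ≤ e i) ∧ (∀ i ∈ M, e i ≤ d i) ∧
      ((∀ i ∈ M, e i = b) ∨ ∀ i ∉ M, e i = a) := by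
  classical
  induction hk : ∑ i ∈ M, d i using Nat.strong_induction_on generalizing d with
  | _ k ih =>
  by_cases h1 : ∀ i ∈ M, d i = b
  · exact ⟨d, hd, fun _ _ => le_rfl, fun _ _ => le_rfl, .inl h1⟩
  by_cases h2 : ∀ i ∉ M, d i = a
  · exact ⟨d, hd, fun _ _ => le_rfl, fun _ _ => le_rfl, .inr h2⟩
  push Not at h1 h2
  obtain ⟨p, hp, hpb⟩ := h1
  obtain ⟨q, hq, hqa⟩ := h2
  obtain ⟨hseq, hda, hdb, hS⟩ := hd
  have hpq : p ≠ q := fun e => hq (e ▸ hp)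
  have hpb' : b < d p := lt_of_le_of_ne (hdb p) (Ne.symm hpb)
  have hqa' : d q < a := lt_of_le_of_ne (hda q) hqa
  -- One unit moves from `p ∈ M` to `q ∉ M`; the sum over `M` drops, so the process ends.
  let d' : Fin n → ℕ := fun i => if i = p then d p - 1 else if i = q then d q + 1 else d i
  have hd'p : d' p = d p - 1 := if_pos rfl
  have hd'q : d' q = d q + 1 := by simp [d', hpq.symm]
  have hd'i : ∀ i, i ≠ p → i ≠ q → d' i = d i := fun i h h' => by simp [d', h, h']
  have hsum : ∑ i, d' i = S := by
    have e1 : ∀ f : Fin n → ℕ, ∑ i, f i = f p + (f q + ∑ i ∈ (univ.erase p).erase q, f i) := by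
      intro f
      rw [add_sum_erase _ _ (mem_erase.2 ⟨hpq.symm, mem_univ q⟩), add_sum_erase _ _ (mem_univ p)]
    have e2 : ∑ i ∈ (univ.erase p).erase q, d' i = ∑ i ∈ (univ.erase p).erase q, d i := by
      refine sum_congr rfl fun i hi => ?_
      simp only [mem_erase] at hi
      exact hd'i i hi.2.1 hi.1
    rw [← hS, e1 d', e1 d, e2, hd'p, hd'q]
    omega
  have hda' : ∀ i, d' i ≤ a := fun i => by
    have := hda i; have := hda p
    simp only [d']; split_ifs <;> omega
  have hdb' : ∀ i, b ≤ d' i := fun i => by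
    have := hdb i; have := hdb q
    simp only [d']; split_ifs <;> omega
  have hmem : d' ∈ simpleRegion n S a b :=
    ⟨⟨fun i => ⟨hb.trans_le (hdb' i), (hda' i).trans_lt ha⟩, by
      rw [hsum, ← hS]; exact hseq.2⟩, hda', hdb', hsum⟩
  have hlt : ∑ i ∈ M, d' i < k := by
    rw [← hk]
    refine sum_lt_sum (fun i hi => ?_) ⟨p, hp, by omega⟩
    have hiq : i ≠ q := fun e => hq (e ▸ hi)
    simp only [d', hiq, if_false]; split_ifs with h
    · subst h; omega
    · exact le_rfl
  obtain ⟨e, he, he1, he2, he3⟩ := ih _ hlt hmem rfl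
  refine ⟨e, he, fun i hi => le_trans ?_ (he1 i hi), fun i hi => (he2 i hi).trans ?_, he3⟩
  · have hip : i ≠ p := fun e => hi (e ▸ hp)
    simp only [d', hip, if_false]; split_ifs with h
    · subst h; omega
    · exact le_rfl
  · have hiq : i ≠ q := fun e => hq (e ▸ hi)
    simp only [d', hiq, if_false]; split_ifs with h
    · subst h; omega
    · exact le_rfl

end Region

end DegreeRegion

namespace DegreeRegion

/-! ### The forbidden partition. -/

section Obstruction

open Finset Classical

variable {n : ℕ}

theorem degree_eq_card_filter (G : SimpleGraph (Fin n)) (v : Fin n) :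
    G.degree v = #{w | G.Adj v w} := by
  rw [← SimpleGraph.card_neighborFinset_eq_degree, SimpleGraph.neighborFinset_eq_filter]

theorem degree_add_degree_compl_eq (G : SimpleGraph (Fin n)) (v : Fin n) :
    #{w | G.Adj v w} + #{w | Gᶜ.Adj v w} = n - 1 := by
  have hc : #(univ.erase v) = n - 1 := by
    rw [card_erase_of_mem (mem_univ v), card_univ, Fintype.card_fin]
  rw [← card_union_of_disjoint, ← hc]
  · congr 1
    ext w
    have := G.ne_of_adj (a := v) (b := w)
    simp only [mem_union, mem_filter, mem_univ, true_and, SimpleGraph.compl_adj, mem_erase]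
    grind
  · rw [disjoint_left]
    intro w hw hw'
    simp only [mem_filter, mem_univ, true_and, SimpleGraph.compl_adj] at hw hw'
    exact hw'.2 hw

/-- A vertex partition into `M` and its complement that no realization of a perturbed member of a
fully graphic region can have: `A` is joined to everything outside `M`, `B` is not joined to
anything in `M`, vertices of `M` have many neighbours in `A` and vertices outside `M` have many
non-neighbours in `B`. -/
theorem FullyGraphic.no_obstruction {S c₁ c₂ : ℕ} (hc₂ : 0 < c₂) (hc₁ : c₁ < n)
    (hfull : FullyGraphic (simpleRegion n S c₁ c₂)) {d : Fin n → ℕ}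
    (hd : d ∈ simpleRegion n S c₁ c₂) {G : SimpleGraph (Fin n)} {x y : Fin n}
    (hG : G ∈ realizations (perturb d x y)) {A B M : Finset (Fin n)}
    (hxA : x ∉ A) (hyA : y ∉ A) (hAM : Disjoint A M)
    (hA : ∀ p ∈ A, ∀ v ∉ M, v ≠ p → G.Adj p v)
    (hyB : y ∈ B) (hBM : B ⊆ M) (hB : ∀ q ∈ B, ∀ q' ∈ M, ¬ G.Adj q q')
    (hM : ∀ v ∈ M, c₂ ≤ #{p ∈ A | G.Adj v p}) (hMy : c₂ + 1 ≤ #{p ∈ A | G.Adj y p})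
    (hN : ∀ v ∉ M, #{w ∈ B | G.Adj v w} + (n - 1 - c₁) ≤ #B) : False := by
  have hdeg := mem_realizations_perturb.1 hG
  obtain ⟨e, he, he1, he2, he3 | he3⟩ := exists_mem_simpleRegion_shift hc₂ hc₁ M hd
  -- `e` is `c₂` on `M`: the inequality for `A` against `M` allows only `c₂ * #M` edges between
  -- them, but `G` has more, because of `y`.
  · have h0 := (hfull e he).sum_le hAM
    have h1 : ∑ p ∈ A, (n - 1 - #M + #{v ∈ M | G.Adj p v}) ≤ ∑ p ∈ A, e p := by
      refine sum_le_sum fun p hp => ?_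
      have hpM := disjoint_left.1 hAM hp
      have hpd : d p = #{w | G.Adj p w} := by
        rw [← degree_eq_card_filter, hdeg p, if_neg (fun h : p = x => hxA (h ▸ hp)),
          if_neg (fun h : p = y => hyA (h ▸ hp)), add_zero, add_zero]
      refine le_trans ?_ (he1 p hpM)
      have hc : #((univ.erase p) \ M) = n - 1 - #M := by
        rw [card_sdiff_of_subset, card_erase_of_mem (mem_univ p), card_univ, Fintype.card_fin]
        intro w hw
        exact mem_erase.2 ⟨fun e => hpM (e ▸ hw), mem_univ w⟩
      rw [hpd, ← hc, ← card_union_of_disjoint]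
      · refine card_le_card fun w hw => ?_
        simp only [mem_union, mem_sdiff, mem_erase, mem_univ, and_true, mem_filter, true_and] at hw ⊢
        rcases hw with hw | hw
        · exact hA p hp w hw.2 hw.1
        · exact hw.2
      · rw [disjoint_left]
        intro w hw hw'
        exact (mem_sdiff.1 hw).2 (mem_filter.1 hw').1
    rw [sum_add_distrib, sum_const, smul_eq_mul] at h1
    have h2 := sum_card_bipartiteAbove_eq_sum_card_bipartiteBelow (s := A) (t := M) G.Adj
    simp only [bipartiteAbove, bipartiteBelow] at h2
    have h3 : ∑ v ∈ M, e v < ∑ v ∈ M, #{p ∈ A | G.Adj p v} := by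
      refine sum_lt_sum (fun v hv => ?_) ⟨y, hBM hyB, ?_⟩
      · rw [he3 v hv]
        simpa only [G.adj_comm] using hM v hv
      · rw [he3 y (hBM hyB)]
        simpa only [G.adj_comm, Nat.lt_iff_add_one_le] using hMy
    omega
  -- `e` is `c₁` outside `M`: the inequality for the complement of `M` against `B` fails, since all
  -- edges at `B` leave `M`, there are at most `#B - (n - 1 - c₁)` per outside vertex, and the extra
  -- degree of `y` makes the comparison strict.
  · have hNB : Disjoint (univ \ M) B := by
      rw [disjoint_left]
      intro v hv hvB
      exact (mem_sdiff.1 hv).2 (hBM hvB)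
    have h0 := (hfull e he).sum_le hNB
    rw [sum_congr rfl fun v hv => he3 v (mem_sdiff.1 hv).2, sum_const, smul_eq_mul] at h0
    have h1 : ∑ v ∈ B, e v < ∑ v ∈ B, #{w ∈ univ \ M | G.Adj w v} := by
      have hB' : ∀ v ∈ B, #{w ∈ univ \ M | G.Adj w v} = #{w | G.Adj v w} := by
        intro v hv
        congr 1
        ext w
        simp only [mem_filter, mem_sdiff, mem_univ, true_and, G.adj_comm w v, and_iff_right_iff_imp]
        exact fun h hw => hB v hv w hw h
      refine sum_lt_sum (fun v hv => ?_) ⟨y, hyB, ?_⟩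
      · rw [hB' v hv, ← degree_eq_card_filter, hdeg v]
        exact (he2 v (hBM hv)).trans (by omega)
      · rw [hB' y hyB, ← degree_eq_card_filter, hdeg y, if_pos rfl]
        exact lt_of_le_of_lt (he2 y (hBM hyB)) (by omega)
    have h2 := sum_card_bipartiteAbove_eq_sum_card_bipartiteBelow (s := univ \ M) (t := B) G.Adj
    simp only [bipartiteAbove, bipartiteBelow] at h2
    have h3 : ∑ v ∈ univ \ M, (#{w ∈ B | G.Adj v w} + (n - 1 - c₁)) ≤ ∑ v ∈ univ \ M, #B :=
      sum_le_sum fun v hv => hN v (mem_sdiff.1 hv).2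
    rw [sum_add_distrib, sum_const, sum_const, smul_eq_mul, smul_eq_mul] at h3
    -- A vertex outside `M` is not in `B`, so `n - 1 - #B` is not truncated.
    rcases (univ \ M).eq_empty_or_nonempty with hem | ⟨v, hv⟩
    · rw [← h2, hem] at h1
      simp at h1
    have hBn : #B ≤ n - 1 := by
      have : #B < #(univ : Finset (Fin n)) := card_lt_card
        ⟨subset_univ _, fun h => disjoint_left.1 hNB hv (h (mem_univ v))⟩
      rw [card_univ, Fintype.card_fin] at this
      omega
    generalize #(univ \ M) = k at h0 h3
    obtain ⟨r, hr⟩ := Nat.exists_eq_add_of_le hBn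
    obtain ⟨s, hs⟩ := Nat.exists_eq_add_of_le (Nat.le_sub_one_of_lt hc₁)
    have e1 : n - 1 - #B = r := by omega
    have e2 : n - 1 - c₁ = s := by omega
    rw [e1] at h0
    rw [e2] at h3
    have e3 : k * (#B + r) = k * (c₁ + s) := by rw [← hr, ← hs]
    rw [mul_add, mul_add] at e3
    omega

end Obstruction

end DegreeRegion

namespace DegreeRegion

/-! ### Trails with up to nine edges. -/

section ShortTrails

variable {V : Type*} {G : SimpleGraph V}

theorem isAltTrail_one {a b : V} (h : G.Adj a b) : IsAltTrail G a b [b] :=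
  ⟨⟨h, rfl⟩, by simp [consecutivePairs], rfl⟩

/-- An edge never coincides with a non-edge, so here and in the longer versions distinctness is
checked only within each kind. -/
theorem isAltTrail_three {a b c d : V} (h₁ : G.Adj a b) (h₂ : Gᶜ.Adj b c) (h₃ : G.Adj c d)
    (hE : [s(a, b), s(c, d)].Nodup) : IsAltTrail G a d [b, c, d] where
  alternates := ⟨h₁, h₂, h₃, rfl⟩
  nodup := by
    have m₁ : s(a, b) ∈ G.edgeSet := h₁
    have m₂ : s(b, c) ∉ G.edgeSet := h₂.2
    have m₃ : s(c, d) ∈ G.edgeSet := h₃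
    simp only [consecutivePairs, List.nodup_cons, List.mem_cons] at hE ⊢
    grind
  last := rfl

theorem isAltTrail_five {a b c d e f : V} (h₁ : G.Adj a b) (h₂ : Gᶜ.Adj b c) (h₃ : G.Adj c d)
    (h₄ : Gᶜ.Adj d e) (h₅ : G.Adj e f) (hE : [s(a, b), s(c, d), s(e, f)].Nodup)
    (hN : [s(b, c), s(d, e)].Nodup) : IsAltTrail G a f [b, c, d, e, f] where
  alternates := ⟨h₁, h₂, h₃, h₄, h₅, rfl⟩
  nodup := by
    have m₁ : s(a, b) ∈ G.edgeSet := h₁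
    have m₂ : s(b, c) ∉ G.edgeSet := h₂.2
    have m₃ : s(c, d) ∈ G.edgeSet := h₃
    have m₄ : s(d, e) ∉ G.edgeSet := h₄.2
    have m₅ : s(e, f) ∈ G.edgeSet := h₅
    simp only [consecutivePairs, List.nodup_cons, List.mem_cons] at hE hN ⊢
    grind
  last := rfl

theorem isAltTrail_seven {a b c d e f g h : V} (h₁ : G.Adj a b) (h₂ : Gᶜ.Adj b c)
    (h₃ : G.Adj c d) (h₄ : Gᶜ.Adj d e) (h₅ : G.Adj e f) (h₆ : Gᶜ.Adj f g) (h₇ : G.Adj g h)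
    (hE : [s(a, b), s(c, d), s(e, f), s(g, h)].Nodup)
    (hN : [s(b, c), s(d, e), s(f, g)].Nodup) : IsAltTrail G a h [b, c, d, e, f, g, h] where
  alternates := ⟨h₁, h₂, h₃, h₄, h₅, h₆, h₇, rfl⟩
  nodup := by
    have m₁ : s(a, b) ∈ G.edgeSet := h₁
    have m₂ : s(b, c) ∉ G.edgeSet := h₂.2
    have m₃ : s(c, d) ∈ G.edgeSet := h₃
    have m₄ : s(d, e) ∉ G.edgeSet := h₄.2
    have m₅ : s(e, f) ∈ G.edgeSet := h₅
    have m₆ : s(f, g) ∉ G.edgeSet := h₆.2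
    have m₇ : s(g, h) ∈ G.edgeSet := h₇
    simp only [consecutivePairs, List.nodup_cons, List.mem_cons] at hE hN ⊢
    clear h₁ h₂ h₃ h₄ h₅ h₆ h₇
    generalize s(a, b) = e₁ at *
    generalize s(b, c) = e₂ at *
    generalize s(c, d) = e₃ at *
    generalize s(d, e) = e₄ at *
    generalize s(e, f) = e₅ at *
    generalize s(f, g) = e₆ at *
    generalize s(g, h) = e₇ at *
    simp only [List.not_mem_nil, or_false, not_or] at hE hN ⊢
    refine ⟨?_, ?_, ?_, ?_⟩ <;> grind
  last := rfl

theorem isAltTrail_nine {a b c d e f g h i j : V} (h₁ : G.Adj a b) (h₂ : Gᶜ.Adj b c)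
    (h₃ : G.Adj c d) (h₄ : Gᶜ.Adj d e) (h₅ : G.Adj e f) (h₆ : Gᶜ.Adj f g) (h₇ : G.Adj g h)
    (h₈ : Gᶜ.Adj h i) (h₉ : G.Adj i j)
    (hE : [s(a, b), s(c, d), s(e, f), s(g, h), s(i, j)].Nodup)
    (hN : [s(b, c), s(d, e), s(f, g), s(h, i)].Nodup) :
    IsAltTrail G a j [b, c, d, e, f, g, h, i, j] where
  alternates := ⟨h₁, h₂, h₃, h₄, h₅, h₆, h₇, h₈, h₉, rfl⟩
  nodup := by
    have m₁ : s(a, b) ∈ G.edgeSet := h₁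
    have m₂ : s(b, c) ∉ G.edgeSet := h₂.2
    have m₃ : s(c, d) ∈ G.edgeSet := h₃
    have m₄ : s(d, e) ∉ G.edgeSet := h₄.2
    have m₅ : s(e, f) ∈ G.edgeSet := h₅
    have m₆ : s(f, g) ∉ G.edgeSet := h₆.2
    have m₇ : s(g, h) ∈ G.edgeSet := h₇
    have m₈ : s(h, i) ∉ G.edgeSet := h₈.2
    have m₉ : s(i, j) ∈ G.edgeSet := h₉
    simp only [consecutivePairs, List.nodup_cons, List.mem_cons] at hE hN ⊢
    clear h₁ h₂ h₃ h₄ h₅ h₆ h₇ h₈ h₉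
    generalize s(a, b) = e₁ at *
    generalize s(b, c) = e₂ at *
    generalize s(c, d) = e₃ at *
    generalize s(d, e) = e₄ at *
    generalize s(e, f) = e₅ at *
    generalize s(f, g) = e₆ at *
    generalize s(g, h) = e₇ at *
    generalize s(h, i) = e₈ at *
    generalize s(i, j) = e₉ at *
    simp only [List.not_mem_nil, or_false, not_or] at hE hN ⊢
    refine ⟨?_, ?_, ?_, ?_⟩ <;> grind
  last := rfl

end ShortTrails

end DegreeRegion

namespace DegreeRegion

/-! ### Structure of a graph without a short trail. -/

section Structure

variable {V : Type*}

/-- `p` is reached from two different neighbours of `y` by a non-edge followed by an edge. -/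
def IsDoublyReached (G : SimpleGraph V) (y p : V) : Prop :=
  ¬ G.Adj y p ∧ ∃ u u' z z', u ≠ u' ∧ G.Adj y u ∧ G.Adj y u' ∧ Gᶜ.Adj u z ∧ Gᶜ.Adj u' z' ∧
    G.Adj z p ∧ G.Adj z' p

/-- As `IsDoublyReached`, by two disjoint paths. -/
def IsDisjointlyReached (G : SimpleGraph V) (y p : V) : Prop :=
  ¬ G.Adj y p ∧ ∃ u u' z z', u ≠ u' ∧ z ≠ z' ∧ G.Adj y u ∧ G.Adj y u' ∧ Gᶜ.Adj u z ∧
    Gᶜ.Adj u' z' ∧ G.Adj z p ∧ G.Adj z' p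

/-- The non-neighbours of `u` span an edge. -/
def IsBad (G : SimpleGraph V) (u : V) : Prop :=
  ∃ q q', G.Adj q q' ∧ Gᶜ.Adj u q ∧ Gᶜ.Adj u q'

/-- The vertices that behave like a dominating clique. -/
def IsUpper (G : SimpleGraph V) (y p : V) : Prop :=
  G.Adj y p ∨ IsDoublyReached G y p

/-- The vertices of the dominating clique through which two trails can be routed. -/
def IsGood (G : SimpleGraph V) (y p : V) : Prop :=
  (G.Adj y p ∧ ¬ IsBad G p) ∨ IsDisjointlyReached G y p

/-- `y`, and the vertices with a non-neighbour in the upper set. -/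
def IsLower (G : SimpleGraph V) (y q : V) : Prop :=
  q = y ∨ ∃ p, IsUpper G y p ∧ Gᶜ.Adj p q

/-- `y`, and the vertices with a good non-neighbour. -/
def IsBottom (G : SimpleGraph V) (y q : V) : Prop :=
  q = y ∨ ∃ p, IsGood G y p ∧ Gᶜ.Adj p q

variable {G : SimpleGraph V} {x y : V}

theorem IsDisjointlyReached.isDoublyReached {p : V} (h : IsDisjointlyReached G y p) :
    IsDoublyReached G y p := by
  obtain ⟨hp, u, u', z, z', hu, -, h⟩ := h
  exact ⟨hp, u, u', z, z', hu, h⟩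

theorem IsGood.isUpper {p : V} (h : IsGood G y p) : IsUpper G y p :=
  h.imp And.left IsDisjointlyReached.isDoublyReached

theorem IsBottom.isLower {q : V} (h : IsBottom G y q) : IsLower G y q :=
  h.imp_right fun ⟨p, hp, hpq⟩ => ⟨p, hp.isUpper, hpq⟩

theorem IsDoublyReached.exists_ne {p : V} (h : IsDoublyReached G y p) (u₀ : V) :
    ∃ u z, u ≠ u₀ ∧ G.Adj y u ∧ Gᶜ.Adj u z ∧ G.Adj z p := by
  obtain ⟨-, u, u', z, z', hne, h1, h2, h3, h4, h5, h6⟩ := h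
  by_cases hu : u = u₀
  · exact ⟨u', z', fun e => hne (hu.trans e.symm), h2, h4, h6⟩
  · exact ⟨u, z, hu, h1, h3, h5⟩

/-- There is no alternating trail with at most nine edges from `y` to `x`. -/
def NoShortTrail (G : SimpleGraph V) (y x : V) : Prop :=
  ∀ l : List V, l.length ≤ 9 → ¬ IsAltTrail G y x l

variable (hsub : ∀ u, G.Adj y u → G.Adj x u) (hT : NoShortTrail G y x)

include hsub

theorem ne_of_neighbor_subset {u : V} (h : G.Adj y u) : u ≠ x ∧ u ≠ y :=
  ⟨(hsub u h).ne', h.ne'⟩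

include hT

/-- An edge `zx` would close the trail `y u z x`. -/
theorem not_adj_of_compl_adj {u z : V} (hu : G.Adj y u) (hz : Gᶜ.Adj u z) :
    ¬ G.Adj x z ∧ ¬ G.Adj y z ∧ z ≠ x ∧ z ≠ y := by
  have hxu := hsub u hu
  have h1 : ¬ G.Adj x z := by
    intro h
    refine hT [u, z, x] (by simp) (isAltTrail_three hu hz h.symm ?_)
    have := hz.1
    have := hxu.ne
    simp only [List.nodup_cons, List.mem_cons, Sym2.eq_iff]
    grind
  refine ⟨h1, fun h => h1 (hsub z h), ?_, ?_⟩
  · rintro rfl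
    exact hz.2 hxu.symm
  · rintro rfl
    exact hz.2 hu.symm

theorem adj_of_neighbors {u u' : V} (hu : G.Adj y u) (hu' : G.Adj y u') (h : u ≠ u') :
    G.Adj u u' := by
  by_contra h'
  exact (not_adj_of_compl_adj hsub hT hu ⟨h, h'⟩).2.1 hu'

theorem IsDoublyReached.ne {p : V} (h : IsDoublyReached G y p) : p ≠ x ∧ p ≠ y := by
  obtain ⟨u, z, -, hu, hz, hzp⟩ := h.exists_ne y
  have := not_adj_of_compl_adj hsub hT hu hz
  constructor
  · rintro rfl
    exact this.1 hzp.symm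
  · rintro rfl
    exact this.2.1 hzp.symm

theorem IsUpper.ne {p : V} (h : IsUpper G y p) : p ≠ x ∧ p ≠ y :=
  h.elim (ne_of_neighbor_subset hsub) (IsDoublyReached.ne hsub hT)

/-- Otherwise reach `p` from some `u' ≠ u` through `z`; the trail is `y u p z u' x`. Double reaching
serves to make `u'` available. -/
theorem IsDoublyReached.adj_neighbor {p u : V} (h : IsDoublyReached G y p) (hu : G.Adj y u) :
    G.Adj u p := by
  by_contra hup
  have hpu : u ≠ p := fun e => h.1 (e ▸ hu)
  obtain ⟨u', z, hne, hu', hz, hzp⟩ := h.exists_ne u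
  have hp := h.ne hsub hT
  have hz' := not_adj_of_compl_adj hsub hT hu' hz
  have hux := ne_of_neighbor_subset hsub hu
  have hux' := ne_of_neighbor_subset hsub hu'
  have hpu' : u' ≠ p := fun e => h.1 (e ▸ hu')
  have hc : Gᶜ.Adj u p := ⟨hpu, hup⟩
  refine hT _ (by simp) (isAltTrail_five hu hc hzp.symm hz.symm (hsub u' hu').symm ?_ ?_)
  all_goals
    simp only [List.nodup_cons, List.mem_cons, Sym2.eq_iff]
    grind

/-- For two doubly reached vertices, a non-edge `pp'` would give the trail `y u z p p' z' u' x`. -/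
theorem IsUpper.adj {p p' : V} (h : IsUpper G y p) (h' : IsUpper G y p') (hne : p ≠ p') :
    G.Adj p p' := by
  rcases h with h | h <;> rcases h' with h' | h'
  · exact adj_of_neighbors hsub hT h h' hne
  · exact h'.adj_neighbor hsub hT h
  · exact (h.adj_neighbor hsub hT h').symm
  by_contra hpp
  have hc : Gᶜ.Adj p p' := ⟨hne, hpp⟩
  obtain ⟨u, z, -, hu, hz, hzp⟩ := h.exists_ne y
  obtain ⟨u', z', hne', hu', hz', hzp'⟩ := h'.exists_ne u
  have hp := h.ne hsub hT
  have hp' := h'.ne hsub hT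
  have nz := not_adj_of_compl_adj hsub hT hu hz
  have nz' := not_adj_of_compl_adj hsub hT hu' hz'
  have nu := ne_of_neighbor_subset hsub hu
  have nu' := ne_of_neighbor_subset hsub hu'
  have a1 : u ≠ p := fun e => h.1 (e ▸ hu)
  have a2 : u' ≠ p := fun e => h.1 (e ▸ hu')
  have a3 : u ≠ p' := fun e => h'.1 (e ▸ hu)
  have a4 : u' ≠ p' := fun e => h'.1 (e ▸ hu')
  have a5 : z ≠ p' := fun e => hz.2 (e ▸ h'.adj_neighbor hsub hT hu)
  have a6 : u ≠ z' := fun e => nz'.2.1 (e ▸ hu)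
  have a7 : u' ≠ z := fun e => nz.2.1 (e ▸ hu')
  refine hT _ (by simp)
    (isAltTrail_seven hu hz hzp hc hzp'.symm hz'.symm (hsub u' hu').symm ?_ ?_)
  all_goals
    simp only [List.nodup_cons, List.mem_cons, Sym2.eq_iff]
    grind

theorem IsUpper.ne_of_isLower {p q : V} (h : IsUpper G y p) (hq : IsLower G y q) : p ≠ q := by
  rintro rfl
  rcases hq with rfl | ⟨p', hp', hc⟩
  · exact (h.ne hsub hT).2 rfl
  · exact hc.2 (hp'.adj hsub hT h hc.1)

theorem not_adj_of_ne_neighbors {u u' q q' : V} (hu : G.Adj y u) (hu' : G.Adj y u') (hne : u ≠ u')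
    (hq : Gᶜ.Adj u q) (hq' : Gᶜ.Adj u' q') : ¬ G.Adj q q' := by
  intro hqq
  have nq := not_adj_of_compl_adj hsub hT hu hq
  have nq' := not_adj_of_compl_adj hsub hT hu' hq'
  have nu := ne_of_neighbor_subset hsub hu
  have nu' := ne_of_neighbor_subset hsub hu'
  have a1 : u ≠ q' := fun e => nq'.2.1 (e ▸ hu)
  refine hT _ (by simp) (isAltTrail_five hu hq hqq hq'.symm (hsub u' hu').symm ?_ ?_)
  all_goals
    simp only [List.nodup_cons, List.mem_cons, Sym2.eq_iff]
    grind

theorem not_adj_of_neighbor_of_isDoublyReached {u p q q' : V} (hu : G.Adj y u)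
    (hp : IsDoublyReached G y p) (hq : Gᶜ.Adj u q) (hq' : Gᶜ.Adj p q') : ¬ G.Adj q q' := by
  intro hqq
  obtain ⟨u', z, hne, hu', hz, hzp⟩ := hp.exists_ne u
  have np := hp.ne hsub hT
  have nz := not_adj_of_compl_adj hsub hT hu' hz
  have nq := not_adj_of_compl_adj hsub hT hu hq
  have nu := ne_of_neighbor_subset hsub hu
  have nu' := ne_of_neighbor_subset hsub hu'
  have up : IsUpper G y p := .inr hp
  have uu : IsUpper G y u := .inl hu
  have uu' : IsUpper G y u' := .inl hu'
  have lq : IsLower G y q := .inr ⟨u, uu, hq⟩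
  have lq' : IsLower G y q' := .inr ⟨p, up, hq'⟩
  have lz : IsLower G y z := .inr ⟨u', uu', hz⟩
  have a1 := up.ne_of_isLower hsub hT lq
  have a2 := up.ne_of_isLower hsub hT lz
  have a3 := uu.ne_of_isLower hsub hT lq'
  have a4 := uu'.ne_of_isLower hsub hT lq'
  have a5 := uu.ne_of_isLower hsub hT lz
  have a6 := uu'.ne_of_isLower hsub hT lq
  have a7 : u ≠ p := fun e => hp.1 (e ▸ hu)
  have a8 : u' ≠ p := fun e => hp.1 (e ▸ hu')
  have := hq.1
  have := hq'.1
  have := hz.1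
  refine hT _ (by simp)
    (isAltTrail_seven hu hq hqq hq'.symm hzp.symm hz.symm (hsub u' hu').symm ?_ ?_)
  all_goals
    simp only [List.nodup_cons, List.mem_cons, Sym2.eq_iff]
    grind

/-- An edge `qq'` would give `y u z p q q' p' z' u' x`, the longest trail used and the source of the
bound nine. The condition `hne` keeps `zp` and `z'p'` distinct; for `p = p'` it calls for disjoint
paths. -/
theorem not_adj_of_reached {u u' z z' p p' q q' : V} (hp : IsDoublyReached G y p)
    (hp' : IsDoublyReached G y p') (hu : G.Adj y u) (hu' : G.Adj y u') (huu : u ≠ u')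
    (hz : Gᶜ.Adj u z) (hz' : Gᶜ.Adj u' z') (hzp : G.Adj z p) (hzp' : G.Adj z' p')
    (hne : p ≠ p' ∨ z ≠ z') (hq : Gᶜ.Adj p q) (hq' : Gᶜ.Adj p' q') : ¬ G.Adj q q' := by
  intro hqq
  have np := hp.ne hsub hT
  have np' := hp'.ne hsub hT
  have nz := not_adj_of_compl_adj hsub hT hu hz
  have nz' := not_adj_of_compl_adj hsub hT hu' hz'
  have nu := ne_of_neighbor_subset hsub hu
  have nu' := ne_of_neighbor_subset hsub hu'
  have up : IsUpper G y p := .inr hp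
  have up' : IsUpper G y p' := .inr hp'
  have uu : IsUpper G y u := .inl hu
  have uu' : IsUpper G y u' := .inl hu'
  have lq : IsLower G y q := .inr ⟨p, up, hq⟩
  have lq' : IsLower G y q' := .inr ⟨p', up', hq'⟩
  have lz : IsLower G y z := .inr ⟨u, uu, hz⟩
  have lz' : IsLower G y z' := .inr ⟨u', uu', hz'⟩
  have key : ∀ {a b}, IsUpper G y a → IsLower G y b → a ≠ b :=
    fun h h' => h.ne_of_isLower hsub hT h'
  have a1 := key uu lz
  have a2 := key uu lz'
  have a3 := key uu lq
  have a4 := key uu lq'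
  have b1 := key uu' lz
  have b2 := key uu' lz'
  have b3 := key uu' lq
  have b4 := key uu' lq'
  have c1 := key up lz
  have c2 := key up lz'
  have c3 := key up lq
  have c4 := key up lq'
  have d1 := key up' lz
  have d2 := key up' lz'
  have d3 := key up' lq
  have d4 := key up' lq'
  have e1 : u ≠ p := fun e => hp.1 (e ▸ hu)
  have e2 : u' ≠ p := fun e => hp.1 (e ▸ hu')
  have e3 : u ≠ p' := fun e => hp'.1 (e ▸ hu)
  have e4 : u' ≠ p' := fun e => hp'.1 (e ▸ hu')
  have e5 : q ≠ q' := hqq.ne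
  refine hT _ (by simp)
    (isAltTrail_nine hu hz hzp hq hqq hq'.symm hzp'.symm hz'.symm (hsub u' hu').symm ?_ ?_)
  all_goals
    clear hT hsub
    simp only [List.nodup_cons, List.mem_cons, Sym2.eq_iff]
    grind

/-- Different upper non-neighbours of `q` and `q'` are linked by a short trail through the edge
`qq'`. Only when they coincide is goodness needed: the common vertex is not bad, or two disjoint
paths reach it. -/
theorem IsBottom.not_adj {q q' : V} (hq : IsBottom G y q) (hq' : IsLower G y q') :
    ¬ G.Adj q q' := by
  intro hqq
  have hlow := hq.isLower
  rcases hq with rfl | ⟨p, hp, hpq⟩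
  · exact IsUpper.ne_of_isLower hsub hT (.inl hqq) hq' rfl
  rcases hq' with rfl | ⟨p', hp', hpq'⟩
  · exact IsUpper.ne_of_isLower hsub hT (.inl hqq.symm) hlow rfl
  rcases hp with ⟨hp, hbad⟩ | hp <;> rcases hp' with hp' | hp'
  · by_cases hpp : p = p'
    · subst hpp
      exact hbad ⟨q, q', hqq, hpq, hpq'⟩
    · exact not_adj_of_ne_neighbors hsub hT hp hp' hpp hpq hpq' hqq
  · exact not_adj_of_neighbor_of_isDoublyReached hsub hT hp hp' hpq hpq' hqq
  · exact not_adj_of_neighbor_of_isDoublyReached hsub hT hp' hp.isDoublyReached hpq' hpq hqq.symm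
  · by_cases hpp : p = p'
    · subst hpp
      obtain ⟨-, u, u', z, z', huu, hzz, hu, hu', hz, hz', hzp, hzp'⟩ := hp
      exact not_adj_of_reached hsub hT hp' hp' hu hu' huu hz hz' hzp hzp' (.inr hzz) hpq hpq' hqq
    · obtain ⟨u, z, -, hu, hz, hzp⟩ := hp.isDoublyReached.exists_ne y
      obtain ⟨u', z', huu, hu', hz', hzp'⟩ := hp'.exists_ne u
      exact not_adj_of_reached hsub hT hp.isDoublyReached hp' hu hu' huu.symm hz hz' hzp hzp'
        (.inl hpp) hpq hpq' hqq

/-- With `qq'` an edge among the non-neighbours of `u`, an edge `ut` would give the trail `y u q q'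
u t u' x`, which passes through `u` twice. -/
theorem IsBad.compl_adj {u u' t : V} (h : IsBad G u) (hu : G.Adj y u) (hu' : G.Adj y u')
    (hne : u ≠ u') (ht : Gᶜ.Adj u' t) : Gᶜ.Adj u t := by
  have hut : u ≠ t := by
    rintro rfl
    exact ht.2 (adj_of_neighbors hsub hT hu' hu hne.symm)
  refine ⟨hut, fun hadj => ?_⟩
  obtain ⟨q, q', hqq, hq, hq'⟩ := h
  have nt := not_adj_of_compl_adj hsub hT hu' ht
  have nq := not_adj_of_compl_adj hsub hT hu hq
  have nq' := not_adj_of_compl_adj hsub hT hu hq'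
  have nu := ne_of_neighbor_subset hsub hu
  have nu' := ne_of_neighbor_subset hsub hu'
  have a1 := hq.1
  have a2 := hq'.1
  have a3 := hqq.ne
  have a4 : u' ≠ q := fun e => nq.2.1 (e ▸ hu')
  refine hT _ (by simp)
    (isAltTrail_seven hu hq hqq hq'.symm hadj ht.symm (hsub u' hu').symm ?_ ?_)
  all_goals
    simp only [List.nodup_cons, List.mem_cons, Sym2.eq_iff]
    grind

theorem IsBad.not_isBad {u u' : V} (h : IsBad G u) (hu : G.Adj y u) (hu' : G.Adj y u')
    (hne : u ≠ u') : ¬ IsBad G u' := by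
  rintro ⟨q, q', hqq, hq, hq'⟩
  exact not_adj_of_ne_neighbors hsub hT hu hu' hne (h.compl_adj hsub hT hu hu' hne hq) hq' hqq

end Structure

end DegreeRegion

namespace DegreeRegion

/-! ### Existence of a short trail, and the count. -/

section Main

open Finset Classical

variable {n : ℕ}

/-- A vertex with many non-neighbours inside `B` has few neighbours there. -/
theorem card_adj_add_le {G : SimpleGraph (Fin n)} {v : Fin n} {B T : Finset (Fin n)} {k : ℕ}
    (hT : T ⊆ B) (hv : ∀ w ∈ T, ¬ G.Adj v w) (hk : k ≤ #T) : #{w ∈ B | G.Adj v w} + k ≤ #B := by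
  have h1 : #({w ∈ B | G.Adj v w} ∪ T) ≤ #B :=
    card_le_card (union_subset (filter_subset _ _) hT)
  rw [card_union_of_disjoint] at h1
  · omega
  · rw [disjoint_left]
    exact fun w hw hw' => hv w hw' (mem_filter.1 hw).2

theorem FullyGraphic.exists_isAltTrail {S c₁ c₂ : ℕ} (hc₂ : 0 < c₂) (hc₁ : c₁ < n)
    (hfull : FullyGraphic (simpleRegion n S c₁ c₂)) {d : Fin n → ℕ}
    (hd : d ∈ simpleRegion n S c₁ c₂) {G : SimpleGraph (Fin n)} {x y : Fin n}
    (hG : G ∈ realizations (perturb d x y)) (hsub : ∀ u, G.Adj y u → G.Adj x u) :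
    ∃ l : List (Fin n), l.length ≤ 9 ∧ IsAltTrail G y x l := by
  by_contra hcon
  have hT : NoShortTrail G y x := fun l hl h => hcon ⟨l, hl, h⟩
  have hdeg := mem_realizations_perturb.1 hG
  obtain ⟨hle, hge⟩ := hd.2.imp_right And.left
  have hdeg_ge : ∀ v, c₂ ≤ #{w | G.Adj v w} := fun v => by
    rw [← degree_eq_card_filter, hdeg v]
    have := hge v
    omega
  have hdeg_y : c₂ + 1 ≤ #{w | G.Adj y w} := by
    rw [← degree_eq_card_filter, hdeg y, if_pos rfl]
    have := hge y
    omega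
  have hcompl : ∀ v, v ≠ x → v ≠ y → n - 1 - c₁ ≤ #{w | Gᶜ.Adj v w} := by
    intro v hx hy
    have h1 := degree_add_degree_compl_eq G v
    have h2 : #{w | G.Adj v w} ≤ c₁ := by
      rw [← degree_eq_card_filter, hdeg v, if_neg hx, if_neg hy]
      exact hle v
    omega
  have hother : ∀ u, ∃ u', G.Adj y u' ∧ u ≠ u' := by
    intro u
    obtain ⟨u', hu', hne⟩ := exists_mem_ne (s := {w | G.Adj y w}) (by omega) u
    exact ⟨u', (mem_filter.1 hu').2, hne.symm⟩
  have hup : ∀ {p q}, IsUpper G y p → ¬ IsLower G y q → q ≠ p → G.Adj p q := by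
    intro p q hp hq hne
    by_contra h
    exact hq (.inr ⟨p, hp, hne.symm, h⟩)
  refine hfull.no_obstruction hc₂ hc₁ hd hG (A := {p | IsUpper G y p})
    (B := {q | IsBottom G y q}) (M := {q | IsLower G y q}) ?_ ?_ ?_ ?_ ?_ ?_ ?_ ?_ ?_ ?_
  · exact fun h => ((mem_filter.1 h).2.ne hsub hT).1 rfl
  · exact fun h => ((mem_filter.1 h).2.ne hsub hT).2 rfl
  · rw [disjoint_left]
    exact fun p hp hp' => (mem_filter.1 hp).2.ne_of_isLower hsub hT (mem_filter.1 hp').2 rfl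
  · intro p hp v hv hne
    exact hup (mem_filter.1 hp).2 (by simpa using hv) hne
  · exact mem_filter.2 ⟨mem_univ _, .inl rfl⟩
  · exact fun q hq => mem_filter.2 ⟨mem_univ _, (mem_filter.1 hq).2.isLower⟩
  · exact fun q hq q' hq' => (mem_filter.1 hq).2.not_adj hsub hT (mem_filter.1 hq').2
  · intro v hv
    have hv' : IsLower G y v := (mem_filter.1 hv).2
    -- If `v` misses two neighbours of `y`, all its neighbours are upper, with `z = z' = v`;
    -- otherwise it sees all but at most one of the at least `c₂ + 1` neighbours of `y`.
    by_cases h : ∃ u u', u ≠ u' ∧ G.Adj y u ∧ G.Adj y u' ∧ ¬ G.Adj v u ∧ ¬ G.Adj v u'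
    · obtain ⟨u, u', hne, hu, hu', hvu, hvu'⟩ := h
      refine (hdeg_ge v).trans (card_le_card fun w hw => ?_)
      have hvw : G.Adj v w := (mem_filter.1 hw).2
      refine mem_filter.2 ⟨mem_filter.2 ⟨mem_univ _, ?_⟩, hvw⟩
      by_cases hyw : G.Adj y w
      · exact .inl hyw
      have key : ∀ {a}, G.Adj y a → ¬ G.Adj v a → Gᶜ.Adj a v := fun ha hva =>
        ⟨IsUpper.ne_of_isLower hsub hT (.inl ha) hv', fun h => hva h.symm⟩
      exact .inr ⟨hyw, u, u', v, v, hne, hu, hu', key hu hvu, key hu' hvu', hvw, hvw⟩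
    · have h1 : #({w | G.Adj y w} : Finset (Fin n)) ≤
          #{p ∈ ({p | IsUpper G y p} : Finset (Fin n)) | G.Adj v p}
            + #{w | G.Adj y w ∧ ¬ G.Adj v w} := by
        refine le_trans (card_le_card fun w hw => ?_) (card_union_le _ _)
        have hyw : G.Adj y w := (mem_filter.1 hw).2
        have : IsUpper G y w := .inl hyw
        simp only [mem_union, mem_filter, mem_univ, true_and]
        tauto
      have h2 : #{w | G.Adj y w ∧ ¬ G.Adj v w} ≤ 1 := by
        refine card_le_one.2 fun u hu u' hu' => ?_
        by_contra hne
        have hu := (mem_filter.1 hu).2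
        have hu' := (mem_filter.1 hu').2
        exact h ⟨u, u', hne, hu.1, hu'.1, hu.2, hu'.2⟩
      omega
  · refine hdeg_y.trans (card_le_card fun w hw => ?_)
    have hyw : G.Adj y w := (mem_filter.1 hw).2
    exact mem_filter.2 ⟨mem_filter.2 ⟨mem_univ _, .inl hyw⟩, hyw⟩
  · intro v hv
    have hv' : ¬ IsLower G y v := by simpa using hv
    have hvy : v ≠ y := fun e => hv' (.inl e)
    have hbottom : ∀ p, IsGood G y p → ({w | Gᶜ.Adj p w} : Finset (Fin n)) ⊆
        ({q | IsBottom G y q} : Finset (Fin n)) := fun p hp w hw =>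
      mem_filter.2 ⟨mem_univ _, .inr ⟨p, hp, (mem_filter.1 hw).2⟩⟩
    -- It suffices to find a good `u` whose non-neighbours all avoid `v`: there are at least `n - 1
    -- - c₁` of them, all in `B`.
    have hgood : ∀ u, IsGood G y u → (∀ z, Gᶜ.Adj u z → ¬ G.Adj v z) →
        #{w ∈ ({q | IsBottom G y q} : Finset (Fin n)) | G.Adj v w} + (n - 1 - c₁)
          ≤ #({q | IsBottom G y q} : Finset (Fin n)) := fun u hu h =>
      card_adj_add_le (hbottom u hu) (fun w hw => h w (mem_filter.1 hw).2)
        (hcompl u (hu.isUpper.ne hsub hT).1 (hu.isUpper.ne hsub hT).2)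
    by_cases hvg : IsGood G y v
    · exact hgood v hvg fun z hz => hz.2
    by_cases hyv : G.Adj y v
    · obtain ⟨u, hu, hne⟩ := hother v
      have hbad : IsBad G v := by
        by_contra h
        exact hvg (.inl ⟨hyv, h⟩)
      exact hgood u (.inl ⟨hu, hbad.not_isBad hsub hT hyv hu hne⟩) fun z hz =>
        (hbad.compl_adj hsub hT hyv hu hne hz).2
    obtain ⟨u, u', hu, hu', hne, hug⟩ : ∃ u u', G.Adj y u ∧ G.Adj y u' ∧ u ≠ u' ∧ ¬ IsBad G u := by
      obtain ⟨u, hu, -⟩ := hother y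
      obtain ⟨u', hu', hne⟩ := hother u
      by_cases hb : IsBad G u
      · exact ⟨u', u, hu', hu, hne.symm, hb.not_isBad hsub hT hu hu' hne⟩
      · exact ⟨u, u', hu, hu', hne, hb⟩
    by_cases hz : ∃ z₁ z₂, z₁ ≠ z₂ ∧ Gᶜ.Adj u z₁ ∧ Gᶜ.Adj u z₂ ∧ G.Adj v z₁ ∧ G.Adj v z₂
    · obtain ⟨z₁, z₂, hzz, h1, h2, h3, h4⟩ := hz
      -- A violating `z` and whichever of `z₁`, `z₂` differs from it would make `v` disjointly
      -- reached, hence good.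
      have hnone : ∀ z, Gᶜ.Adj u' z → ¬ G.Adj v z := by
        intro z hz hvz
        refine hvg (.inr ⟨hyv, ?_⟩)
        by_cases hz1 : z = z₁
        · exact ⟨u', u, z, z₂, hne.symm, hz1 ▸ hzz, hu', hu, hz, h2, hvz.symm, h4.symm⟩
        · exact ⟨u', u, z, z₁, hne.symm, hz1, hu', hu, hz, h1, hvz.symm, h3.symm⟩
      refine hgood u' (.inl ⟨hu', fun hb => ?_⟩) hnone
      exact hnone z₁ (hb.compl_adj hsub hT hu' hu hne.symm h1) h3
    · have hug' : IsGood G y u := .inl ⟨hu, hug⟩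
      have hyu : y ∉ ({w | Gᶜ.Adj u w ∧ ¬ G.Adj v w} : Finset (Fin n)) := fun h =>
        (mem_filter.1 h).2.1.2 hu.symm
      -- `v` sees at most one non-neighbour of `u`, and `y` makes up for that loss.
      refine card_adj_add_le (T := insert y ({w | Gᶜ.Adj u w ∧ ¬ G.Adj v w} : Finset (Fin n))) ?_ ?_ ?_
      · intro w hw
        rcases mem_insert.1 hw with rfl | hw
        · exact mem_filter.2 ⟨mem_univ _, .inl rfl⟩
        · exact hbottom u hug' (mem_filter.2 ⟨mem_univ _, (mem_filter.1 hw).2.1⟩)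
      · intro w hw
        rcases mem_insert.1 hw with rfl | hw
        · exact fun h => hyv h.symm
        · exact (mem_filter.1 hw).2.2
      · rw [card_insert_of_notMem hyu]
        have h1 : #({w | Gᶜ.Adj u w} : Finset (Fin n)) ≤
            #{w | Gᶜ.Adj u w ∧ ¬ G.Adj v w} + #{w | Gᶜ.Adj u w ∧ G.Adj v w} := by
          refine le_trans (card_le_card fun w hw => ?_) (card_union_le _ _)
          have : Gᶜ.Adj u w := (mem_filter.1 hw).2
          simp only [mem_union, mem_filter, mem_univ, true_and]
          tauto
        have h2 : #{w | Gᶜ.Adj u w ∧ G.Adj v w} ≤ 1 := by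
          refine card_le_one.2 fun z₁ h1 z₂ h2 => ?_
          by_contra hzz
          have h1 := (mem_filter.1 h1).2
          have h2 := (mem_filter.1 h2).2
          exact hz ⟨z₁, z₂, hzz, h1.1, h2.1, h1.2, h2.2⟩
        have h3 := hcompl u (hsub u hu).ne' hu.ne'
        omega

theorem IsAltTrail.exists_pathGraph {d : Fin n → ℕ} {G : SimpleGraph (Fin n)} {x y : Fin n}
    (hG : G ∈ realizations (perturb d x y)) {l : List (Fin n)} (hl : l.length ≤ 9)
    (h : IsAltTrail G x y l) :
    ∃ l : List (Fin n), l.length = 10 ∧ G ∆ pathGraph l ∈ realizations d := by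
  -- Nine edges need ten vertices; shorter trails are padded with their last vertex.
  refine ⟨(x :: l) ++ List.replicate (9 - l.length) y, ?_, ?_⟩
  · simp
    omega
  · rw [pathGraph_append_replicate _ _ h.last]
    exact h.degree_symmDiff (mem_realizations_perturb.1 hG)

theorem perturb_comm (d : Fin n → ℕ) (i j : Fin n) : perturb d i j = perturb d j i := by
  simp only [perturb]
  abel

/-- Replacing the edge `yw` by the non-edge `wx`. -/
theorem exists_pathGraph_mem_perturb_self {d : Fin n → ℕ} {G : SimpleGraph (Fin n)}
    {x y w : Fin n} (hG : G ∈ realizations (perturb d x y)) (hyw : G.Adj y w) (hwx : Gᶜ.Adj w x) :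
    G ∆ pathGraph [y, w, x] ∈ realizations (perturb d x x) := by
  rw [mem_realizations_perturb] at hG ⊢
  have hne : s(y, w) ≠ s(w, x) := by
    intro e
    rcases Sym2.eq_iff.1 e with h | h
    · exact hyw.ne h.1
    · exact hwx.2 (h.1 ▸ hyw.symm)
  have h2 : (G ∆ SimpleGraph.edge y w)ᶜ.Adj w x :=
    ⟨hwx.1, by rw [symmDiff_edge_adj_of_ne G hne]; exact hwx.2⟩
  have e : G ∆ pathGraph [y, w, x] = (G ∆ SimpleGraph.edge y w) ∆ SimpleGraph.edge w x := by
    rw [pathGraph, pathGraph, pathGraph, symmDiff_bot, symmDiff_assoc]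
  intro v
  have h3 := degree_symmDiff_edge_of_adj hyw v
  have h4 := degree_symmDiff_edge_of_not_adj h2 v
  have h5 := hG v
  rw [e, h4]
  omega

theorem ncard_perturb_self_le {S c₁ c₂ : ℕ} (hc₂ : 0 < c₂) (hc₁ : c₁ < n)
    (hfull : FullyGraphic (simpleRegion n S c₁ c₂)) {d : Fin n → ℕ}
    (hd : d ∈ simpleRegion n S c₁ c₂) (x : Fin n) :
    (realizations (perturb d x x)).ncard ≤ n ^ 10 * (realizations d).ncard := by
  have := ncard_le_of_exists_pathGraph 10 (s := realizations (perturb d x x))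
    (t := realizations d) fun G hG => by
      obtain ⟨l, hl, h⟩ := hfull.exists_isAltTrail hc₂ hc₁ hd hG fun _ h => h
      exact h.exists_pathGraph hG hl
  simpa using this

theorem ncard_perturb_le {S c₁ c₂ : ℕ} (hc₂ : 0 < c₂) (hc₁ : c₁ < n)
    (hfull : FullyGraphic (simpleRegion n S c₁ c₂)) {d : Fin n → ℕ}
    (hd : d ∈ simpleRegion n S c₁ c₂) (x y : Fin n) :
    (realizations (perturb d x y)).ncard ≤ 2 * n ^ 11 * (realizations d).ncard := by
  let s : Set (SimpleGraph (Fin n)) := {G | ∃ l : List (Fin n), l.length = 10 ∧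
    G ∆ pathGraph l ∈ realizations d}
  let t : Set (SimpleGraph (Fin n)) := {G | ∃ w, G ∆ pathGraph [y, w, x] ∈
    realizations (perturb d x x)}
  have hst : realizations (perturb d x y) ⊆ s ∪ t := by
    intro G hG
    have hG' : G ∈ realizations (perturb d y x) := perturb_comm d x y ▸ hG
    by_cases hsub : ∀ u, G.Adj y u → G.Adj x u
    · obtain ⟨l, hl, h⟩ := hfull.exists_isAltTrail hc₂ hc₁ hd hG hsub
      exact .inl (h.exists_pathGraph hG' hl)
    push Not at hsub
    obtain ⟨w, hyw, hxw⟩ := hsub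
    by_cases hwx : w = x
    · subst hwx
      exact .inl ((isAltTrail_one hyw).exists_pathGraph hG' (by simp))
    · exact .inr ⟨w, exists_pathGraph_mem_perturb_self hG hyw ⟨hwx, fun h => hxw h.symm⟩⟩
  have hs : s.ncard ≤ n ^ 10 * (realizations d).ncard := by
    simpa using ncard_le_of_exists_pathGraph 10 (s := s) fun G hG => hG
  have ht : t.ncard ≤ n * (realizations (perturb d x x)).ncard := by
    simpa using ncard_le_of_exists_symmDiff (s := t) (fun w => pathGraph [y, w, x]) fun G hG => hG
  have hn : n ^ 10 ≤ n ^ 11 := Nat.pow_le_pow_right (by omega) (by omega)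
  calc (realizations (perturb d x y)).ncard ≤ (s ∪ t).ncard := Set.ncard_le_ncard hst
    _ ≤ s.ncard + t.ncard := Set.ncard_union_le s t
    _ ≤ n ^ 11 * (realizations d).ncard + n * (n ^ 10 * (realizations d).ncard) :=
      Nat.add_le_add (hs.trans (Nat.mul_le_mul_right _ hn))
        (ht.trans (Nat.mul_le_mul_left _ (ncard_perturb_self_le hc₂ hc₁ hfull hd x)))
    _ = 2 * n ^ 11 * (realizations d).ncard := by ring

theorem boundary_le_boundaryWithDiagonal (d : Fin n → ℕ) :
    boundary d ≤ boundaryWithDiagonal d := by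
  refine sum_le_sum_of_subset_of_nonneg (fun p hp => ?_) fun p _ _ => by positivity
  simp only [mem_filter, mem_univ, true_and] at hp ⊢
  exact hp.le

theorem boundaryWithDiagonal_le {S c₁ c₂ : ℕ} (hc₂ : 0 < c₂) (hc₁ : c₁ < n)
    (hfull : FullyGraphic (simpleRegion n S c₁ c₂)) {d : Fin n → ℕ}
    (hd : d ∈ simpleRegion n S c₁ c₂) : boundaryWithDiagonal d ≤ 2 * (n : ℚ) ^ 13 := by
  have h1 : ∀ p : Fin n × Fin n, ((realizations (perturb d p.1 p.2)).ncard : ℚ) /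
      ((realizations d).ncard : ℚ) ≤ 2 * (n : ℚ) ^ 11 := by
    intro p
    -- A zero denominator would be harmless, as the quotient is then `0`.
    refine div_le_of_le_mul₀ (by positivity) (by positivity) ?_
    exact_mod_cast ncard_perturb_le hc₂ hc₁ hfull hd p.1 p.2
  calc boundaryWithDiagonal d
      ≤ ∑ p : Fin n × Fin n, ((realizations (perturb d p.1 p.2)).ncard : ℚ) /
          ((realizations d).ncard : ℚ) :=
        sum_le_sum_of_subset_of_nonneg (filter_subset _ _) fun p _ _ => by positivity
    _ ≤ ∑ _p : Fin n × Fin n, 2 * (n : ℚ) ^ 11 := sum_le_sum fun p _ => h1 p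
    _ = 2 * (n : ℚ) ^ 13 := by
      rw [sum_const, card_univ, Fintype.card_prod, Fintype.card_fin, nsmul_eq_mul]
      push_cast
      ring

end Main

end DegreeRegion

theorem theorem1p3 (n S c₁ c₂ : ℕ) (hc₂ : 0 < c₂) (hc : c₂ ≤ c₁) (hc₁ : c₁ < n)
    (hfull : DegreeRegion.FullyGraphic (DegreeRegion.simpleRegion n S c₁ c₂)) :
    ∀ D ∈ DegreeRegion.simpleRegion n S c₁ c₂,
      DegreeRegion.boundary D ≤ 3 * (n : ℚ) ^ 13 ∧
      DegreeRegion.boundaryWithDiagonal D ≤ 3 * (n : ℚ) ^ 13 := by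
  intro D hD
  have h1 := DegreeRegion.boundaryWithDiagonal_le hc₂ hc₁ hfull hD
  have h2 := DegreeRegion.boundary_le_boundaryWithDiagonal D
  have h3 : (0 : ℚ) ≤ (n : ℚ) ^ 13 := by positivity
  constructor <;> linarith
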